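/- Let $H=(V,E,w)$ be a finite weighted hypergraph: $V$ is a finite set, $E$ is a set of nonempty subsets of $V$, and $w\colon E\to\mathbb{R}_{>0}$. Write $u\sim v$ if some $e\in E$ contains both $u$ and $v$, and assume that $H$ is connected, i.e. any two vertices are joined by a finite sequence of vertices in which consecutive terms are related by $\sim$. Let $d(u,v)$ be the least length $n$ of a sequence $u=z_0\sim z_1\sim\dots\sim z_n=v$. Put $d_v=\sum_{e\ni v}w_e$, $D=\mathrm{diag}(d_v)$, and $\langle f,g\rangle=\sum_{v\in V}f(v)g(v)d_v^{-1}$ on $\mathbb{R}^V$. For $e\in E$ let $B_e=\mathrm{Conv}\{\delta_u-\delta_v : u,v\in e\}$, where $\delta_u$ is the characteristic function of $u$. The multivalued Laplacian and its normalized version are $$L(f)=\Big\{\sum_{e\in E}w_e\,\mathtt b_e(\mathtt b_e^{\top}f)\;:\;\mathtt b_e\in\operatorname{argmax}_{\mathtt b\in B_e}\mathtt b^{\top}f\Big\},\qquad \mathcal L(f)=L(D^{-1}f),$$ and for $\lambda>0$ the resolvent is $J_\lambda f=(I+\lambda\mathcal L)^{-1}f=\{g : f\in g+\lambda\mathcal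 L(g)\}$, which consists of a single function. Let $\mathsf{Lip}^1_w(V)$ be the set of $f\in\mathbb{R}^V$ with $|f(u)/d_u-f(v)/d_v|\le d(u,v)$ for all $u,v\in V$, and let $$\mathsf{KD}_\lambda(x,y)=\sup\{\langle J_\lambda f,\delta_x\rangle-\langle J_\lambda f,\delta_y\rangle : f\in\mathsf{Lip}^1_w(V)\},\qquad \kappa_\lambda(x,y)=1-\frac{\mathsf{KD}_\lambda(x,y)}{d(x,y)}.$$ **Theorem.** For every finite connected weighted hypergraph $H$ and all distinct vertices $x,y\in V$, the number $\mathsf{KD}_\lambda(x,y)$ is finite for every $\lambda>0$, and the lower and upper coarse Ricci curvatures $$\underline\kappa(x,y)=\liminf_{\lambda\downarrow0}\frac{\kappa_\lambda(x,y)}{\lambda},\qquad \overline\kappa(x,y)=\limsup_{\lambda\downarrow0}\frac{\kappa_\lambda(x,y)}{\lambda}$$ coincide. Their common value is a real number $\kappa(x,y)$, so that the limit $$\kappa(x,y)=\lim_{\lambda\downarrow0}\frac1\lambda\left(1-\frac{\mathsf{KD}_\lambda(x,y)}{d(x,y)}\right)$$ exists and is finite. -/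

import Mathlib

open Filter Topology

/-- A weighted undirected hypergraph whose set of vertices is the whole type `V`: the hyperedges are
nonempty sets of vertices, and every hyperedge carries a positive weight. (Values of `weight` on
sets that are not hyperedges are never used.) -/
structure WeightedHypergraph (V : Type*) extends Hypergraph V where
  vertexSet_eq_univ : vertexSet = Set.univ
  edge_nonempty : ∀ e ∈ edgeSet, e.Nonempty
  weight : Set V → ℝ
  weight_pos : ∀ e ∈ edgeSet, 0 < weight e

namespace WeightedHypergraph

noncomputable section

variable {V : Type*} (H : WeightedHypergraph V)

/-- There is a sequence `z 0 = x, z 1, …, z n = y` of vertices in which any two consecutive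
vertices lie in a common hyperedge. -/
def HasPath (n : ℕ) (x y : V) : Prop :=
  ∃ z : ℕ → V, z 0 = x ∧ z n = y ∧ ∀ i < n, H.Adj (z i) (z (i + 1))

/-- Any two vertices are joined by a path. -/
def Connected : Prop := ∀ x y : V, ∃ n : ℕ, H.HasPath n x y

/-- The distance: the least length of a path (the set is nonempty when `H` is connected). -/
def dist (x y : V) : ℕ := sInf {n : ℕ | H.HasPath n x y}

variable [Fintype V]

/-- The finite set of hyperedges. -/
def edges : Finset (Set V) := H.edgeSet.toFinite.toFinset

theorem mem_edges {e : Set V} : e ∈ H.edges ↔ e ∈ H.edgeSet := by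
  simp [edges]

variable [DecidableEq V]

open Classical in
/-- The degree `d_x`, the sum of the weights of the hyperedges that contain `x`. -/
def deg (x : V) : ℝ := ∑ e ∈ H.edges with x ∈ e, H.weight e

/-- The inner product `⟨f, g⟩ = ∑ x, f x * g x / d_x`. -/
def inner (f g : V → ℝ) : ℝ := ∑ x, f x * g x * (H.deg x)⁻¹

/-- The characteristic function `δ_x`. -/
def delta (x : V) : V → ℝ := Pi.single x 1

/-- The base polytope `B_e`, the convex hull of the vectors `δ_x - δ_y` with `x, y ∈ e`. -/
def basePolytope (e : Set V) : Set (V → ℝ) :=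
  convexHull ℝ {v | ∃ x ∈ e, ∃ y ∈ e, v = delta x - delta y}

/-- The set of maximizers of `b ↦ bᵀ f` over the base polytope `B_e`. -/
def argmaxBase (e : Set V) (f : V → ℝ) : Set (V → ℝ) :=
  {b | b ∈ basePolytope e ∧ ∀ b' ∈ basePolytope e, dotProduct b' f ≤ dotProduct b f}

/-- The multivalued hypergraph Laplacian
`L f = {∑ e, w_e (b_eᵀ f) b_e ; b_e ∈ argmax_{b ∈ B_e} bᵀ f}`. -/
def laplacian (f : V → ℝ) : Set (V → ℝ) :=
  {g | ∃ b : Set V → V → ℝ, (∀ e ∈ H.edges, b e ∈ argmaxBase e f) ∧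
    g = ∑ e ∈ H.edges, (H.weight e * dotProduct (b e) f) • b e}

/-- The normalized Laplacian `f ↦ L (D⁻¹ f)`. -/
def normLaplacian (f : V → ℝ) : Set (V → ℝ) := H.laplacian fun x => f x / H.deg x

/-- The resolvent `J_lam = (I + lam 𝓛)⁻¹` of the normalized Laplacian `𝓛`, as an operator with
values in subsets: `g` belongs to `J_lam f` when `f ∈ g + lam 𝓛 g`. -/
def resolvent (lam : ℝ) (f : V → ℝ) : Set (V → ℝ) :=
  {g | ∃ v ∈ H.normLaplacian g, f = g + lam • v}

/-- The weighted `K`-Lipschitz functions: those `f` for which `D⁻¹ f` is `K`-Lipschitz. -/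
def weightedLip (K : ℝ) : Set (V → ℝ) :=
  {f | ∀ x y : V, |f x / H.deg x - f y / H.deg y| ≤ K * H.dist x y}

/-- The numbers `⟨J_lam f, δ_x⟩ - ⟨J_lam f, δ_y⟩` with `f` weighted `1`-Lipschitz. -/
def kdSet (lam : ℝ) (x y : V) : Set ℝ :=
  {r | ∃ f ∈ H.weightedLip 1, ∃ g ∈ H.resolvent lam f,
    r = H.inner g (delta x) - H.inner g (delta y)}

/-- The nonlinear Kantorovich difference `KD_lam (x, y)`. -/
def kd (lam : ℝ) (x y : V) : ℝ := sSup (H.kdSet lam x y)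

/-- The `lam`-coarse Ricci curvature `κ_lam (x, y) = 1 - KD_lam (x, y) / d (x, y)`. -/
def curvature (lam : ℝ) (x y : V) : ℝ := 1 - H.kd lam x y / H.dist x y

/-- The lower coarse Ricci curvature, the limit inferior of `κ_lam (x, y) / lam` as `lam ↓ 0`. -/
def lowerCurvature (x y : V) : EReal :=
  liminf (fun lam : ℝ => ((H.curvature lam x y / lam : ℝ) : EReal)) (𝓝[>] 0)

/-- The upper coarse Ricci curvature, the limit superior of `κ_lam (x, y) / lam` as `lam ↓ 0`. -/
def upperCurvature (x y : V) : EReal :=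
  limsup (fun lam : ℝ => ((H.curvature lam x y / lam : ℝ) : EReal)) (𝓝[>] 0)

end

end WeightedHypergraph

set_option linter.unusedSectionVars false

/-! Writing `h` for `D⁻¹ J_lam f`, the Kantorovich difference is the supremum of `h x - h y` over
the `h` for which some element of `h + lam D⁻¹ L h` is 1-Lipschitz (`mem_kdSet_iff`). Such data may
be taken bounded independently of `lam`, so `kd` differs from the distance `d` by `O(lam)`
(`exists_kd_bounds`), and only oscillation of the quotient `(d - kd) / lam` has to be excluded.

The Laplacian is piecewise linear: the maximizers depend only on how the differences of `h` are
ordered, and there are finitely many orders. Near-optimal witnesses `h n` for parameters `l n → 0`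
can thus be chosen with one order and with a limit `φ`, and they share maximizers with `φ`. Along
the segment from `φ` to a fixed `h m` the Laplacian then has an affine selection. The point with
parameter `s = lam / l m` is, after a rescaling by `1 + o(1) lam`, a witness for every `lam < l m`
(`eventually_le_kd`). Hence a value `a` undercut along one sequence is almost attained for all small
`lam`, and the quotient converges. -/

namespace WeightedHypergraph

/-! ### The distance and Lipschitz functions -/

section Distance

variable {V : Type*} {H : WeightedHypergraph V}

theorem HasPath.symm {n : ℕ} {x y : V} (h : H.HasPath n x y) : H.HasPath n y x := by
  obtain ⟨z, h0, hn, hz⟩ := h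
  refine ⟨fun i => z (n - i), by simpa using hn, by simpa using h0, fun i hi => ?_⟩
  have h1 := (hz (n - (i + 1)) (by omega)).symm
  rwa [show n - (i + 1) + 1 = n - i by omega] at h1

theorem HasPath.trans {m n : ℕ} {x y z : V} (h₁ : H.HasPath m x y) (h₂ : H.HasPath n y z) :
    H.HasPath (m + n) x z := by
  obtain ⟨p, p0, pm, hp⟩ := h₁
  obtain ⟨q, q0, qn, hq⟩ := h₂
  refine ⟨fun i => if i ≤ m then p i else q (i - m), by simpa using p0, ?_, fun i hi => ?_⟩
  · by_cases h : n = 0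
    · subst h
      simp [pm, ← q0, qn]
    · simp [h, qn]
  · rcases lt_trichotomy i m with h | h | h
    · simpa [h.le, Nat.succ_le_of_lt h] using hp i h
    · subst h
      simpa [pm, ← q0] using hq 0 (by omega)
    · have h1 := hq (i - m) (by omega)
      rw [show i - m + 1 = i + 1 - m by omega] at h1
      simpa [not_le.2 h, show ¬ i + 1 ≤ m by omega] using h1

theorem Connected.hasPath_dist (hH : H.Connected) (x y : V) : H.HasPath (H.dist x y) x y :=
  Nat.sInf_mem (hH x y)

theorem HasPath.dist_le {n : ℕ} {x y : V} (h : H.HasPath n x y) : H.dist x y ≤ n :=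
  Nat.sInf_le h

theorem dist_self (x : V) : H.dist x x = 0 :=
  Nat.le_zero.1 (HasPath.dist_le ⟨fun _ => x, rfl, rfl, by simp⟩)

theorem Connected.dist_comm (hH : H.Connected) (x y : V) : H.dist x y = H.dist y x :=
  le_antisymm (hH.hasPath_dist y x).symm.dist_le (hH.hasPath_dist x y).symm.dist_le

theorem Connected.dist_triangle (hH : H.Connected) (x y z : V) :
    H.dist x z ≤ H.dist x y + H.dist y z :=
  ((hH.hasPath_dist x y).trans (hH.hasPath_dist y z)).dist_le

theorem Connected.one_le_dist (hH : H.Connected) {x y : V} (hxy : x ≠ y) : 1 ≤ H.dist x y := by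
  by_contra h
  obtain ⟨z, h0, hn, -⟩ := hH.hasPath_dist x y
  rw [show H.dist x y = 0 by omega] at hn
  exact hxy (h0.symm.trans hn)

/-- `K`-Lipschitz functions for the distance of the hypergraph. -/
def IsLip (H : WeightedHypergraph V) (K : ℝ) (f : V → ℝ) : Prop :=
  ∀ u v : V, |f u - f v| ≤ K * H.dist u v

theorem Connected.isLip_dist (hH : H.Connected) (y : V) : H.IsLip 1 fun u => (H.dist u y : ℝ) := by
  intro u v
  have h1 : (H.dist u y : ℝ) ≤ H.dist u v + H.dist v y := mod_cast hH.dist_triangle u v y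
  have h2 : (H.dist v y : ℝ) ≤ H.dist v u + H.dist u y := mod_cast hH.dist_triangle v u y
  rw [hH.dist_comm v u] at h2
  rw [abs_le]
  constructor <;> linarith

/-- Distinct vertices are at distance at least 1, so the oscillation `2 * ε` of a small perturbation
is absorbed by the Lipschitz constant. -/
theorem IsLip.add_of_abs_le (hH : H.Connected) {K ε : ℝ} {f g : V → ℝ} (hf : H.IsLip K f)
    (hg : ∀ z, |g z| ≤ ε) : H.IsLip (K + 2 * ε) (f + g) := by
  intro u v
  rcases eq_or_ne u v with rfl | huv
  · simp [dist_self]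
  · have h1 : (1 : ℝ) ≤ H.dist u v := mod_cast hH.one_le_dist huv
    have hε : 0 ≤ ε := (abs_nonneg _).trans (hg u)
    have h2 := hf u v
    have h3 := hg u
    have h4 := hg v
    rw [abs_le] at h2 h3 h4 ⊢
    have h5 : 2 * ε * 1 ≤ 2 * ε * H.dist u v := by gcongr
    simp only [Pi.add_apply, add_mul]
    constructor <;> linarith

theorem IsLip.convexComb {K s : ℝ} (hs0 : 0 ≤ s) (hs1 : s ≤ 1) {f g : V → ℝ} (hf : H.IsLip K f)
    (hg : H.IsLip K g) : H.IsLip K ((1 - s) • f + s • g) := by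
  intro u v
  have h1 : ((1 - s) • f + s • g) u - ((1 - s) • f + s • g) v
      = (1 - s) * (f u - f v) + s * (g u - g v) := by
    simp only [Pi.add_apply, Pi.smul_apply, smul_eq_mul]; ring
  rw [h1]
  calc _ ≤ (1 - s) * |f u - f v| + s * |g u - g v| := by
        refine (abs_add_le _ _).trans_eq ?_
        rw [abs_mul, abs_mul, abs_of_nonneg hs0, abs_of_nonneg (sub_nonneg.2 hs1)]
    _ ≤ (1 - s) * (K * H.dist u v) + s * (K * H.dist u v) := by
        have := sub_nonneg.2 hs1
        gcongr
        · exact hf u v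
        · exact hg u v
    _ = _ := by ring

theorem isLip_of_tendsto {K : ℝ} {f : ℕ → V → ℝ} {g : V → ℝ} (hf : ∀ n, H.IsLip K (f n))
    (hg : Tendsto f atTop (𝓝 g)) : H.IsLip K g := by
  intro u v
  rw [tendsto_pi_nhds] at hg
  exact le_of_tendsto ((hg u).sub (hg v)).abs (Eventually.of_forall fun n => hf n u v)

end Distance

/-! ### Base polytopes and their maximizers -/

section BasePolytope

variable {V : Type*} [Fintype V] [DecidableEq V] {e : Set V} {b f g : V → ℝ}

theorem delta_sub_delta_dotProduct (u v : V) (f : V → ℝ) :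
    dotProduct (delta u - delta v) f = f u - f v := by
  simp [delta, sub_dotProduct]

theorem finite_generators (e : Set V) :
    {v : V → ℝ | ∃ x ∈ e, ∃ y ∈ e, v = delta x - delta y}.Finite := by
  refine (Set.finite_range fun p : V × V => (delta p.1 - delta p.2 : V → ℝ)).subset ?_
  rintro _ ⟨x, -, y, -, rfl⟩
  exact ⟨(x, y), rfl⟩

theorem isCompact_basePolytope (e : Set V) : IsCompact (basePolytope e) :=
  (finite_generators e).isCompact_convexHull ℝ

theorem zero_mem_basePolytope (he : e.Nonempty) : (0 : V → ℝ) ∈ basePolytope e := by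
  obtain ⟨x, hx⟩ := he
  exact subset_convexHull ℝ _ ⟨x, hx, x, hx, by simp⟩

theorem norm_le_of_mem_basePolytope (hb : b ∈ basePolytope e) : ‖b‖ ≤ 2 := by
  have h : basePolytope e ⊆ Metric.closedBall (0 : V → ℝ) 2 := by
    refine convexHull_min ?_ (convex_closedBall _ _)
    rintro _ ⟨x, -, y, -, rfl⟩
    rw [mem_closedBall_zero_iff]
    refine (norm_sub_le _ _).trans ?_
    have h1 (z : V) : ‖(delta z : V → ℝ)‖ ≤ 1 := by simp [delta, Pi.norm_single]
    linarith [h1 x, h1 y]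
  exact mem_closedBall_zero_iff.1 (h hb)

/-- The coordinates of every vector of the base polytope sum to zero. -/
theorem dotProduct_sub_const (hb : b ∈ basePolytope e) (c : ℝ) :
    dotProduct b (fun z => f z - c) = dotProduct b f := by
  have h : basePolytope e ⊆ {b : V → ℝ | ∑ z, b z = 0} := by
    refine convexHull_min ?_ ?_
    · rintro _ ⟨x, -, y, -, rfl⟩
      simp [delta]
    · intro b hb b' hb' s t _ _ _
      simp only [Set.mem_ofPred_eq] at *
      simp [Finset.sum_add_distrib, ← Finset.mul_sum, hb, hb']
  simp [dotProduct, mul_sub, Finset.sum_sub_distrib, ← Finset.sum_mul,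
    show ∑ z, b z = 0 from h hb]

theorem exists_mem_argmaxBase (he : e.Nonempty) (f : V → ℝ) : ∃ b, b ∈ argmaxBase e f := by
  obtain ⟨b, hb, hmax⟩ := (isCompact_basePolytope e).exists_isMaxOn
    ⟨0, zero_mem_basePolytope he⟩ (f := fun b => dotProduct b f)
    (by unfold dotProduct; fun_prop)
  exact ⟨b, hb, fun b' hb' => hmax hb'⟩

theorem dotProduct_nonneg_of_mem_argmaxBase (he : e.Nonempty) (hb : b ∈ argmaxBase e f) :
    0 ≤ dotProduct b f := by
  simpa using hb.2 0 (zero_mem_basePolytope he)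

theorem dotProduct_eq_of_mem_argmaxBase {b' : V → ℝ} (hb : b ∈ argmaxBase e f)
    (hb' : b' ∈ argmaxBase e f) : dotProduct b f = dotProduct b' f :=
  le_antisymm (hb'.2 _ hb.1) (hb.2 _ hb'.1)

theorem smul_mem_argmaxBase {c : ℝ} (hc : 0 ≤ c) (hb : b ∈ argmaxBase e f) :
    b ∈ argmaxBase e (c • f) := by
  refine ⟨hb.1, fun b' hb' => ?_⟩
  simp only [dotProduct_smul, smul_eq_mul]
  exact mul_le_mul_of_nonneg_left (hb.2 b' hb') hc

theorem sub_const_mem_argmaxBase (hb : b ∈ argmaxBase e f) (c : ℝ) :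
    b ∈ argmaxBase e (fun z => f z - c) := by
  refine ⟨hb.1, fun b' hb' => ?_⟩
  rw [dotProduct_sub_const hb.1, dotProduct_sub_const hb']
  exact hb.2 b' hb'

theorem mem_argmaxBase_of_tendsto {b' : ℕ → V → ℝ} {f' : ℕ → V → ℝ}
    (h : ∀ n, b' n ∈ argmaxBase e (f' n)) (hb : Tendsto b' atTop (𝓝 b))
    (hf : Tendsto f' atTop (𝓝 f)) : b ∈ argmaxBase e f := by
  refine ⟨(isCompact_basePolytope e).isClosed.mem_of_tendsto hb
    (Eventually.of_forall fun n => (h n).1), fun c hc => ?_⟩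
  have hcont : Continuous fun p : (V → ℝ) × (V → ℝ) => dotProduct p.1 p.2 := by
    unfold dotProduct; fun_prop
  exact le_of_tendsto_of_tendsto ((hcont.tendsto (c, f)).comp (tendsto_const_nhds.prodMk_nhds hf))
    ((hcont.tendsto (b, f)).comp (hb.prodMk_nhds hf))
    (Eventually.of_forall fun n => (h n).2 c hc)

/-- The comparison of the differences of the values of a function. -/
def diffOrder (f : V → ℝ) : V → V → V → V → Prop := fun u v u' v' => f u - f v ≤ f u' - f v'

/-- The maximizers depend only on the order of the differences of `f`. -/
theorem argmaxBase_subset_of_diffOrder_eq (h : diffOrder f = diffOrder g) :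
    argmaxBase e f ⊆ argmaxBase e g := by
  intro b hb
  have hne : {v : V → ℝ | ∃ x ∈ e, ∃ y ∈ e, v = delta x - delta y}.Nonempty :=
    convexHull_nonempty_iff.1 ⟨b, hb.1⟩
  obtain ⟨_, ⟨x, hx, y, hy, rfl⟩, hmax⟩ :=
    Set.exists_max_image _ (fun c => dotProduct c f) (finite_generators e) hne
  simp only [delta_sub_delta_dotProduct] at hmax
  -- The last condition says that maximizing `f` forces maximizing `g`. It passes to convex
  -- combinations because these reach the maximum only if every term of positive weight does.
  have key : basePolytope e ⊆ {c : V → ℝ | dotProduct c f ≤ f x - f y ∧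
      dotProduct c g ≤ g x - g y ∧ (f x - f y ≤ dotProduct c f → g x - g y ≤ dotProduct c g)} := by
    refine convexHull_min ?_ ?_
    · rintro _ ⟨u, hu, v, hv, rfl⟩
      have h1 : f u - f v ≤ f x - f y := by
        rw [← delta_sub_delta_dotProduct u v]
        exact hmax _ ⟨u, hu, v, hv, rfl⟩
      have h2 (u v u' v' : V) : f u - f v ≤ f u' - f v' ↔ g u - g v ≤ g u' - g v' :=
        iff_of_eq (congrFun (congrFun (congrFun (congrFun h u) v) u') v')
      simp only [Set.mem_ofPred_eq, delta_sub_delta_dotProduct]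
      exact ⟨h1, (h2 _ _ _ _).1 h1, (h2 _ _ _ _).1⟩
    · rintro c ⟨h1, h2, h3⟩ c' ⟨h1', h2', h3'⟩ s t hs ht hst
      simp only [Set.mem_ofPred_eq, add_dotProduct, smul_dotProduct, smul_eq_mul]
      refine ⟨?_, ?_, fun hm => ?_⟩
      · calc _ ≤ s * (f x - f y) + t * (f x - f y) := by gcongr
          _ = _ := by rw [← add_mul, hst, one_mul]
      · calc _ ≤ s * (g x - g y) + t * (g x - g y) := by gcongr
          _ = _ := by rw [← add_mul, hst, one_mul]
      · obtain rfl : t = 1 - s := by linarith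
        rcases hs.eq_or_lt with rfl | hs
        · simpa using h3' (by simpa using hm)
        rcases ht.eq_or_lt with ht | ht
        · obtain rfl : s = 1 := by linarith
          simpa using h3 (by simpa using hm)
        have e1 : f x - f y ≤ dotProduct c f := by nlinarith
        have e2 : f x - f y ≤ dotProduct c' f := by nlinarith
        nlinarith [h3 e1, h3' e2]
  have hb' := key hb.1
  refine ⟨hb.1, fun c hc => (key hc).2.1.trans (hb'.2.2 ?_)⟩
  rw [← delta_sub_delta_dotProduct]
  exact hb.2 _ (subset_convexHull ℝ _ ⟨x, hx, y, hy, rfl⟩)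

/-- If the same vectors maximize both functions, then the convex combinations of the two Laplacian
terms are Laplacian terms of the convex combinations of the functions. -/
theorem exists_mem_argmaxBase_convexComb (he : e.Nonempty) {b₀ b₁ : V → ℝ}
    (h₀f : b₀ ∈ argmaxBase e f) (h₀g : b₀ ∈ argmaxBase e g) (h₁f : b₁ ∈ argmaxBase e f)
    (h₁g : b₁ ∈ argmaxBase e g) {s : ℝ} (hs0 : 0 ≤ s) (hs1 : s ≤ 1) :
    ∃ b ∈ argmaxBase e ((1 - s) • f + s • g),
      dotProduct b ((1 - s) • f + s • g) • b
        = (1 - s) • dotProduct b₀ f • b₀ + s • dotProduct b₁ g • b₁ := by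
  have hs1' := sub_nonneg.2 hs1
  have hf := dotProduct_eq_of_mem_argmaxBase h₁f h₀f
  have hg := dotProduct_eq_of_mem_argmaxBase h₀g h₁g
  have hp := mul_nonneg hs1' (dotProduct_nonneg_of_mem_argmaxBase he h₀f)
  have hq := mul_nonneg hs0 (dotProduct_nonneg_of_mem_argmaxBase he h₁g)
  set p := (1 - s) * dotProduct b₀ f with hpdef
  set q := s * dotProduct b₁ g with hqdef
  have hle : ∀ c ∈ basePolytope e, dotProduct c ((1 - s) • f + s • g) ≤ p + q := by
    intro c hc
    simp only [dotProduct_add, dotProduct_smul, smul_eq_mul, hpdef, hqdef]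
    gcongr
    · exact h₀f.2 c hc
    · exact h₁g.2 c hc
  have heq₀ : dotProduct b₀ ((1 - s) • f + s • g) = p + q := by
    simp only [dotProduct_add, dotProduct_smul, smul_eq_mul, hpdef, hqdef, hg]
  have heq₁ : dotProduct b₁ ((1 - s) • f + s • g) = p + q := by
    simp only [dotProduct_add, dotProduct_smul, smul_eq_mul, hpdef, hqdef, hf]
  simp only [smul_smul, ← hpdef, ← hqdef]
  -- If `p + q = 0`, both terms vanish and any maximizer serves. Otherwise the weights `p / (p + q)`
  -- and `q / (p + q)` are forced by the common maximum `p + q`.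
  rcases (add_nonneg hp hq).eq_or_lt with h | h
  · refine ⟨b₀, ⟨h₀f.1, fun c hc => (hle c hc).trans_eq heq₀.symm⟩, ?_⟩
    rw [heq₀, ← h, show p = 0 by linarith, show q = 0 by linarith]
    simp
  · have heq : dotProduct ((p / (p + q)) • b₀ + (q / (p + q)) • b₁) ((1 - s) • f + s • g)
        = p + q := by
      rw [add_dotProduct, smul_dotProduct, smul_dotProduct, heq₀, heq₁]
      simp only [smul_eq_mul]
      field_simp
    refine ⟨(p / (p + q)) • b₀ + (q / (p + q)) • b₁,
      ⟨convex_convexHull ℝ _ h₀f.1 h₁f.1 (by positivity) (by positivity) (by field_simp),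
        fun c hc => (hle c hc).trans_eq heq.symm⟩, ?_⟩
    rw [heq, smul_add, smul_smul, smul_smul, mul_div_cancel₀ _ h.ne', mul_div_cancel₀ _ h.ne']

end BasePolytope
end WeightedHypergraph

namespace WeightedHypergraph

/-! ### Selections of the Laplacian -/

section Laplacian

variable {V : Type*} [Fintype V] [DecidableEq V] {H : WeightedHypergraph V}
  {b : Set V → V → ℝ} {h : V → ℝ}

/-- A choice of a maximizer for every hyperedge. -/
def IsSelection (H : WeightedHypergraph V) (b : Set V → V → ℝ) (h : V → ℝ) : Prop :=
  ∀ e ∈ H.edges, b e ∈ argmaxBase e h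

/-- The element of `D⁻¹ L h` that belongs to a choice of maximizers. -/
noncomputable def selLaplacian (H : WeightedHypergraph V) (b : Set V → V → ℝ) (h : V → ℝ) : V → ℝ :=
  fun z => (∑ e ∈ H.edges, (H.weight e * dotProduct (b e) h) * b e z) / H.deg z

theorem nonempty_of_mem_edges {e : Set V} (he : e ∈ H.edges) : e.Nonempty :=
  H.edge_nonempty e (H.mem_edges.1 he)

theorem weight_pos_of_mem_edges {e : Set V} (he : e ∈ H.edges) : 0 < H.weight e :=
  H.weight_pos e (H.mem_edges.1 he)

/-- The first step of a path from `z` to another vertex provides a hyperedge through `z`. -/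
theorem Connected.deg_pos (hH : H.Connected) [Nontrivial V] (z : V) : 0 < H.deg z := by
  classical
  obtain ⟨u, hu⟩ := exists_ne z
  obtain ⟨p, p0, pn, hp⟩ := hH.hasPath_dist z u
  obtain ⟨e, he, hz, -⟩ := hp 0 (hH.one_le_dist hu.symm)
  rw [p0] at hz
  refine Finset.sum_pos (fun e he => weight_pos_of_mem_edges (Finset.mem_filter.1 he).1)
    ⟨e, Finset.mem_filter.2 ⟨H.mem_edges.2 he, hz⟩⟩

theorem exists_isSelection (H : WeightedHypergraph V) (h : V → ℝ) : ∃ b, H.IsSelection b h := by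
  have h1 : ∀ e : Set V, ∃ b, e ∈ H.edges → b ∈ argmaxBase e h := fun e => by
    by_cases he : e ∈ H.edges
    · obtain ⟨b, hb⟩ := exists_mem_argmaxBase (nonempty_of_mem_edges he) h
      exact ⟨b, fun _ => hb⟩
    · exact ⟨0, fun h => absurd h he⟩
  choose b hb using h1
  exact ⟨b, hb⟩

theorem inner_delta (g : V → ℝ) (x : V) : H.inner g (delta x) = g x / H.deg x := by
  simp [inner, delta, Pi.single_apply, div_eq_mul_inv]

theorem IsSelection.smul {c : ℝ} (hc : 0 ≤ c) (hb : H.IsSelection b h) :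
    H.IsSelection b (c • h) :=
  fun e he => smul_mem_argmaxBase hc (hb e he)

theorem IsSelection.sub_const (hb : H.IsSelection b h) (c : ℝ) :
    H.IsSelection b (fun z => h z - c) :=
  fun e he => sub_const_mem_argmaxBase (hb e he) c

theorem selLaplacian_smul (H : WeightedHypergraph V) (b : Set V → V → ℝ) (h : V → ℝ) (c : ℝ) :
    H.selLaplacian b (c • h) = c • H.selLaplacian b h := by
  funext z
  simp only [selLaplacian, dotProduct_smul, Pi.smul_apply, smul_eq_mul]
  rw [← mul_div_assoc, Finset.mul_sum]
  congr 1
  exact Finset.sum_congr rfl fun e _ => by ring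

theorem IsSelection.selLaplacian_sub_const (hb : H.IsSelection b h) (c : ℝ) :
    H.selLaplacian b (fun z => h z - c) = H.selLaplacian b h := by
  funext z
  simp only [selLaplacian]
  congr 1
  exact Finset.sum_congr rfl fun e he => by rw [dotProduct_sub_const (hb e he).1]

theorem selLaplacian_congr {b' : Set V → V → ℝ} (hb : ∀ e ∈ H.edges, b e = b' e) :
    H.selLaplacian b h = H.selLaplacian b' h := by
  funext z
  simp only [selLaplacian]
  congr 1
  exact Finset.sum_congr rfl fun e he => by rw [hb e he]

/-- The degrees cancel, and the sum becomes `∑ w_e (b_eᵀ h)²`. -/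
theorem energy_nonneg (hdeg : ∀ z, 0 < H.deg z) (b : Set V → V → ℝ) (h : V → ℝ) :
    0 ≤ ∑ z, H.deg z * (h z * H.selLaplacian b h z) := by
  have h1 : ∑ z, H.deg z * (h z * H.selLaplacian b h z)
      = ∑ e ∈ H.edges, H.weight e * dotProduct (b e) h ^ 2 := by
    calc _ = ∑ z, ∑ e ∈ H.edges, h z * ((H.weight e * dotProduct (b e) h) * b e z) := by
          refine Finset.sum_congr rfl fun z _ => ?_
          have := (hdeg z).ne'
          rw [← Finset.mul_sum, selLaplacian]
          field_simp
      _ = _ := by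
          rw [Finset.sum_comm]
          refine Finset.sum_congr rfl fun e _ => ?_
          rw [pow_two, ← mul_assoc]
          conv_rhs => rw [dotProduct, Finset.mul_sum]
          exact Finset.sum_congr rfl fun z _ => by rw [dotProduct]; ring
  rw [h1]
  exact Finset.sum_nonneg fun e he =>
    mul_nonneg (weight_pos_of_mem_edges he).le (sq_nonneg _)

theorem continuous_selLaplacian (H : WeightedHypergraph V) :
    Continuous fun p : (V → ℝ) × (Set V → V → ℝ) => H.selLaplacian p.2 p.1 := by
  unfold selLaplacian dotProduct
  simp only [div_eq_mul_inv]
  fun_prop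

theorem IsSelection.exists_convexComb {b₀ b₁ : Set V → V → ℝ} {f g : V → ℝ}
    (h₀f : H.IsSelection b₀ f) (h₀g : H.IsSelection b₀ g) (h₁f : H.IsSelection b₁ f)
    (h₁g : H.IsSelection b₁ g) {s : ℝ} (hs0 : 0 ≤ s) (hs1 : s ≤ 1) :
    ∃ b, H.IsSelection b ((1 - s) • f + s • g) ∧ H.selLaplacian b ((1 - s) • f + s • g)
      = (1 - s) • H.selLaplacian b₀ f + s • H.selLaplacian b₁ g := by
  have h1 : ∀ e : Set V, ∃ b, e ∈ H.edges → b ∈ argmaxBase e ((1 - s) • f + s • g) ∧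
      dotProduct b ((1 - s) • f + s • g) • b
        = (1 - s) • dotProduct (b₀ e) f • b₀ e + s • dotProduct (b₁ e) g • b₁ e := fun e => by
    by_cases he : e ∈ H.edges
    · obtain ⟨b, hb, hb'⟩ := exists_mem_argmaxBase_convexComb (nonempty_of_mem_edges he)
        (h₀f e he) (h₀g e he) (h₁f e he) (h₁g e he) hs0 hs1
      exact ⟨b, fun _ => ⟨hb, hb'⟩⟩
    · exact ⟨0, fun h => absurd h he⟩
  choose b hb using h1
  refine ⟨b, fun e he => (hb e he).1, ?_⟩
  funext z
  simp only [selLaplacian, Pi.add_apply, Pi.smul_apply, smul_eq_mul]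
  rw [← mul_div_assoc, ← mul_div_assoc, ← add_div, Finset.mul_sum, Finset.mul_sum,
    ← Finset.sum_add_distrib]
  congr 1
  refine Finset.sum_congr rfl fun e he => ?_
  have h2 := congrFun (hb e he).2 z
  simp only [Pi.add_apply, Pi.smul_apply, smul_eq_mul] at h2
  linear_combination H.weight e * h2

end Laplacian

/-! ### Uniform bounds for the Kantorovich difference -/

section Resolvent

variable {V : Type*} [Fintype V] [DecidableEq V] {H : WeightedHypergraph V}
  {b : Set V → V → ℝ} {h : V → ℝ} {lam : ℝ} {x y : V}

theorem mem_kdSet_iff (hdeg : ∀ z, 0 < H.deg z) {r : ℝ} :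
    r ∈ H.kdSet lam x y ↔ ∃ h b, H.IsSelection b h ∧
      H.IsLip 1 (h + lam • H.selLaplacian b h) ∧ r = h x - h y := by
  have hd z := (hdeg z).ne'
  constructor
  · rintro ⟨f, hf, g, ⟨v, ⟨b, hb, rfl⟩, rfl⟩, rfl⟩
    refine ⟨fun z => g z / H.deg z, b, hb, ?_, by simp only [inner_delta]⟩
    intro u v
    convert hf u v using 3 <;>
    simp [selLaplacian, add_div, mul_div_assoc]
  · rintro ⟨h, b, hb, hf, rfl⟩
    have hdiv : (fun z => H.deg z * h z / H.deg z) = h :=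
      funext fun z => mul_div_cancel_left₀ _ (hd z)
    refine ⟨_, ?_, fun z => H.deg z * h z, ⟨_, ⟨b, by rwa [hdiv], rfl⟩, rfl⟩, ?_⟩
    · intro u v
      rw [hdiv]
      convert hf u v using 3 <;>
      simp [selLaplacian, add_div, mul_div_assoc, hd]
    · simp [inner_delta, hd]

/-- Positive homogeneity of the Laplacian: a witness with Lipschitz constant `K` is divided by `K`.
-/
theorem IsSelection.div_mem_kdSet (hdeg : ∀ z, 0 < H.deg z) {K : ℝ} (hK : 0 < K)
    (hb : H.IsSelection b h) (hf : H.IsLip K (h + lam • H.selLaplacian b h)) :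
    (h x - h y) / K ∈ H.kdSet lam x y := by
  refine (mem_kdSet_iff hdeg).2 ⟨K⁻¹ • h, b, hb.smul (by positivity), fun u v => ?_, ?_⟩
  · have h1 : (K⁻¹ • h + lam • H.selLaplacian b (K⁻¹ • h)) u
        - (K⁻¹ • h + lam • H.selLaplacian b (K⁻¹ • h)) v
        = K⁻¹ * ((h + lam • H.selLaplacian b h) u - (h + lam • H.selLaplacian b h) v) := by
      simp only [selLaplacian_smul, Pi.add_apply, Pi.smul_apply, smul_eq_mul]
      ring
    rw [h1, abs_mul, abs_of_pos (inv_pos.2 hK)]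
    calc _ ≤ K⁻¹ * (K * H.dist u v) := by gcongr; exact hf u v
      _ = _ := by field_simp
  · simp only [Pi.smul_apply, smul_eq_mul]
    ring

theorem exists_abs_selLaplacian_le (H : WeightedHypergraph V) (R : ℝ) :
    ∃ M, 0 ≤ M ∧ ∀ (h : V → ℝ) (b : Set V → V → ℝ), ‖(h, b)‖ ≤ R →
      ∀ z, |H.selLaplacian b h z| ≤ M := by
  obtain ⟨M, hM⟩ := (isCompact_closedBall (0 : (V → ℝ) × (Set V → V → ℝ)) R).exists_bound_of_continuousOn
    H.continuous_selLaplacian.continuousOn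
  refine ⟨max M 0, le_max_right _ _, fun h b hb z => le_max_of_le_left ?_⟩
  exact (norm_le_pi_norm (H.selLaplacian b h) z).trans (hM (h, b) (mem_closedBall_zero_iff.2 hb))

/-- The resolvent does not increase the weighted Euclidean norm. -/
theorem sum_deg_mul_sq_le (hdeg : ∀ z, 0 < H.deg z) (hlam : 0 ≤ lam) (b : Set V → V → ℝ)
    (h : V → ℝ) : ∑ z, H.deg z * h z ^ 2
      ≤ ∑ z, H.deg z * (h + lam • H.selLaplacian b h) z ^ 2 := by
  have h1 := mul_nonneg hlam (energy_nonneg hdeg b h)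
  have h2 : 0 ≤ ∑ z, H.deg z * (lam * H.selLaplacian b h z) ^ 2 :=
    Finset.sum_nonneg fun z _ => mul_nonneg (hdeg z).le (sq_nonneg _)
  have h3 : ∑ z, H.deg z * (h + lam • H.selLaplacian b h) z ^ 2
      = ∑ z, H.deg z * h z ^ 2 + 2 * (lam * ∑ z, H.deg z * (h z * H.selLaplacian b h z))
        + ∑ z, H.deg z * (lam * H.selLaplacian b h z) ^ 2 := by
    simp only [Finset.mul_sum, ← Finset.sum_add_distrib, Pi.add_apply, Pi.smul_apply, smul_eq_mul]
    exact Finset.sum_congr rfl fun z _ => by ring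
  linarith

/-- The elements of `kdSet` come from a bounded set of data. -/
theorem exists_bounded_representation (hdeg : ∀ z, 0 < H.deg z) (x y : V) :
    ∃ R, ∀ lam > 0, ∀ r ∈ H.kdSet lam x y, ∃ h b, ‖(h, b)‖ ≤ R ∧ H.IsSelection b h ∧
      H.IsLip 1 (h + lam • H.selLaplacian b h) ∧ r = h x - h y := by
  classical
  set Q : ℝ := ∑ z, H.deg z * (H.dist z y : ℝ) ^ 2
  obtain ⟨R, hR⟩ : ∃ R : ℝ, ∀ z, √(Q / H.deg z) ≤ R := by
    obtain ⟨R, hR⟩ := (Set.finite_range fun z => √(Q / H.deg z)).bddAbove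
    exact ⟨R, fun z => hR ⟨z, rfl⟩⟩
  have hR0 : 0 ≤ R := (Real.sqrt_nonneg _).trans (hR y)
  refine ⟨max R 2, fun lam hlam r hr => ?_⟩
  obtain ⟨h₀, b₀, hb₀, hf₀, rfl⟩ := (mem_kdSet_iff hdeg).1 hr
  -- Subtracting a constant leaves the Laplacian unchanged. This choice makes the Lipschitz function
  -- vanish at `y`, so that it is bounded by the distance to `y`.
  set c := (h₀ + lam • H.selLaplacian b₀ h₀) y with hc
  set h : V → ℝ := fun z => h₀ z - c with hh
  -- A selection is unconstrained off the hyperedges; the value 0 there keeps its norm bounded.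
  set b : Set V → V → ℝ := fun e => if e ∈ H.edges then b₀ e else 0 with hb
  have hbb₀ : ∀ e ∈ H.edges, b e = b₀ e := fun e he => if_pos he
  have hsel : H.IsSelection b h := fun e he => by
    rw [hbb₀ e he]
    exact hb₀.sub_const c e he
  have hlap : H.selLaplacian b h = H.selLaplacian b₀ h₀ := by
    rw [selLaplacian_congr hbb₀, hh, hb₀.selLaplacian_sub_const]
  have hval (z : V) : (h + lam • H.selLaplacian b h) z
      = (h₀ + lam • H.selLaplacian b₀ h₀) z - c := by
    rw [hlap]
    simp only [hh, Pi.add_apply]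
    ring
  refine ⟨h, b, ?_, hsel, fun u v => ?_, by simp [hh]⟩
  · rw [Prod.norm_mk]
    refine max_le_max ((pi_norm_le_iff_of_nonneg hR0).2 fun z => ?_)
      ((pi_norm_le_iff_of_nonneg (by norm_num)).2 fun e => ?_)
    · refine (Real.abs_le_sqrt ?_).trans (hR z)
      rw [le_div_iff₀ (hdeg z), mul_comm]
      calc H.deg z * h z ^ 2 ≤ ∑ z, H.deg z * h z ^ 2 :=
            Finset.single_le_sum (f := fun z => H.deg z * h z ^ 2)
              (fun z _ => mul_nonneg (hdeg z).le (sq_nonneg _)) (Finset.mem_univ z)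
        _ ≤ _ := sum_deg_mul_sq_le hdeg hlam.le b h
        _ ≤ Q := by
            refine Finset.sum_le_sum fun z _ => mul_le_mul_of_nonneg_left ?_ (hdeg z).le
            rw [hval, hc]
            refine sq_le_sq' ?_ ?_ <;> have := abs_le.1 (hf₀ z y) <;> linarith
    · by_cases he : e ∈ H.edges
      · exact norm_le_of_mem_basePolytope (hsel e he).1
      · simp [hb, he]
  · rw [hval, hval, sub_sub_sub_cancel_right]
    exact hf₀ u v

/-- Up to an error that is linear in `lam`, the Kantorovich difference is the distance. -/
theorem exists_kd_bounds (hH : H.Connected) (hdeg : ∀ z, 0 < H.deg z) (x y : V) :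
    ∃ C, ∀ lam > 0, (∀ r ∈ H.kdSet lam x y, r ≤ H.dist x y + C * lam) ∧
      ∃ r ∈ H.kdSet lam x y, H.dist x y - C * lam ≤ r := by
  obtain ⟨R, hR⟩ := exists_bounded_representation hdeg x y
  obtain ⟨M, hM0, hM⟩ := exists_abs_selLaplacian_le H R
  set φ : V → ℝ := fun u => (H.dist u y : ℝ) with hφ
  obtain ⟨b₀, hb₀⟩ := exists_isSelection H φ
  obtain ⟨M', hM'0, hM'⟩ := exists_abs_selLaplacian_le H ‖(φ, b₀)‖
  -- The first constant bounds `lam` times a difference of two Laplacian values. The second comes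
  -- from the witness `φ / (1 + 2 * lam * M')`, where `φ` is the distance to `y`.
  refine ⟨max (2 * M) (H.dist x y * (2 * M')), fun lam hlam => ⟨fun r hr => ?_, ?_⟩⟩
  · obtain ⟨h, b, hn, -, hf, rfl⟩ := hR lam hlam r hr
    have h1 := (abs_le.1 (hf x y)).2
    have h2 := mul_le_mul_of_nonneg_right (le_max_left (2 * M) (H.dist x y * (2 * M'))) hlam.le
    have h3 := mul_le_mul_of_nonneg_right (abs_le.1 (hM h b hn y)).2 hlam.le
    have h4 := mul_le_mul_of_nonneg_right (abs_le.1 (hM h b hn x)).1 hlam.le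
    simp only [Pi.add_apply, Pi.smul_apply, smul_eq_mul] at h1
    linarith
  · have hK : 0 < 1 + 2 * (lam * M') := by positivity
    refine ⟨_, hb₀.div_mem_kdSet hdeg hK ((hH.isLip_dist y).add_of_abs_le hH fun z => ?_), ?_⟩
    · rw [Pi.smul_apply, smul_eq_mul, abs_mul, abs_of_pos hlam]
      exact mul_le_mul_of_nonneg_left (hM' φ b₀ le_rfl z) hlam.le
    · have h2 := mul_le_mul_of_nonneg_right (le_max_right (2 * M) (H.dist x y * (2 * M'))) hlam.le
      refine (sub_le_sub_left h2 _).trans ?_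
      simp only [hφ, dist_self]
      rw [le_div_iff₀ hK]
      have : 0 ≤ (H.dist x y : ℝ) * (lam * M') ^ 2 := by positivity
      simp only [Nat.cast_zero, sub_zero]
      nlinarith

theorem isLUB_kdSet (hH : H.Connected) (hdeg : ∀ z, 0 < H.deg z) (x y : V) (hlam : 0 < lam) :
    IsLUB (H.kdSet lam x y) (H.kd lam x y) := by
  obtain ⟨C, hC⟩ := exists_kd_bounds hH hdeg x y
  obtain ⟨r, hr, -⟩ := (hC lam hlam).2
  exact isLUB_csSup ⟨r, hr⟩ ⟨_, (hC lam hlam).1⟩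

end Resolvent
end WeightedHypergraph

namespace WeightedHypergraph

/-! ### Existence of the limit -/

section Limit

variable {V : Type*} [Fintype V] [DecidableEq V] {H : WeightedHypergraph V} {x y : V}

/-- A sequence of bounded data with the same order of the differences has a subsequence along which
the data converge, and the maximizers are then shared with the limit. -/
theorem exists_limit_data {R : ℝ} {h : ℕ → V → ℝ} {b : ℕ → Set V → V → ℝ}
    (hn : ∀ n, ‖(h n, b n)‖ ≤ R) (hb : ∀ n, H.IsSelection (b n) (h n))
    (ht : ∀ m n, diffOrder (h m) = diffOrder (h n)) :
    ∃ φ b₀, ∃ k : ℕ → ℕ, StrictMono k ∧ Tendsto (fun n => h (k n)) atTop (𝓝 φ) ∧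
      Tendsto (fun n => H.selLaplacian (b (k n)) (h (k n))) atTop (𝓝 (H.selLaplacian b₀ φ)) ∧
      H.IsSelection b₀ φ ∧ ∀ n, H.IsSelection b₀ (h n) ∧ H.IsSelection (b n) φ := by
  obtain ⟨⟨φ, b₀⟩, -, k, hk, hlim⟩ :=
    (isCompact_closedBall (0 : (V → ℝ) × (Set V → V → ℝ)) R).tendsto_subseq
      (x := fun n => (h n, b n)) fun n => mem_closedBall_zero_iff.2 (hn n)
  have hφ : Tendsto (fun n => h (k n)) atTop (𝓝 φ) := (continuous_fst.tendsto _).comp hlim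
  have hb₀ : Tendsto (fun n => b (k n)) atTop (𝓝 b₀) := (continuous_snd.tendsto _).comp hlim
  rw [tendsto_pi_nhds] at hb₀
  -- The limit `φ` may have more ties than the `h n`, so only the sequence members are compared by
  -- order; `φ` and `b₀` are reached by closedness of the maximizer relation.
  have hcross (m n : ℕ) : H.IsSelection (b m) (h n) := fun e he =>
    argmaxBase_subset_of_diffOrder_eq (ht m n) (hb m e he)
  have hu : Tendsto (fun n => H.selLaplacian (b (k n)) (h (k n))) atTop
      (𝓝 (H.selLaplacian b₀ φ)) := by
    have h1 := (H.continuous_selLaplacian.tendsto (φ, b₀)).comp hlim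
    simpa only [Function.comp_def] using h1
  have h₀ : H.IsSelection b₀ φ := fun e he =>
    mem_argmaxBase_of_tendsto (fun n => hb (k n) e he) (hb₀ e) hφ
  refine ⟨φ, b₀, k, hk, hφ, hu, h₀, fun n => ⟨fun e he => ?_, fun e he => ?_⟩⟩
  · exact mem_argmaxBase_of_tendsto (f' := fun _ => h n) (fun m => hcross (k m) n e he) (hb₀ e)
      tendsto_const_nhds
  · exact mem_argmaxBase_of_tendsto (b' := fun _ => b n e) (fun m => hcross n (k m) e he)
      tendsto_const_nhds hφ

/-- If the Kantorovich difference is frequently larger than `d - a lam`, then there is a sequence of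
witnesses with the same order of the differences. -/
theorem exists_seq_of_frequently (hH : H.Connected) (hdeg : ∀ z, 0 < H.deg z) {a : ℝ}
    (hfreq : ∃ᶠ lam in 𝓝[>] (0 : ℝ), H.dist x y - a * lam < H.kd lam x y) :
    ∃ R, ∃ l : ℕ → ℝ, ∃ h : ℕ → V → ℝ, ∃ b : ℕ → Set V → V → ℝ,
      Tendsto l atTop (𝓝 0) ∧ (∀ n, 0 < l n) ∧ (∀ n, ‖(h n, b n)‖ ≤ R) ∧
      (∀ n, H.IsSelection (b n) (h n)) ∧ (∀ m n, diffOrder (h m) = diffOrder (h n)) ∧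
      (∀ n, H.IsLip 1 (h n + l n • H.selLaplacian (b n) (h n))) ∧
      ∀ n, H.dist x y - a * l n < h n x - h n y := by
  obtain ⟨R, hR⟩ := exists_bounded_representation hdeg x y
  have h1 : ∃ᶠ lam in 𝓝[>] (0 : ℝ), ∃ t : V → V → V → V → Prop, 0 < lam ∧ ∃ h b,
      ‖(h, b)‖ ≤ R ∧ H.IsSelection b h ∧ diffOrder h = t ∧
      H.IsLip 1 (h + lam • H.selLaplacian b h) ∧ H.dist x y - a * lam < h x - h y := by
    refine (hfreq.and_eventually self_mem_nhdsWithin).mono fun lam ⟨hlt, hlam⟩ => ?_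
    obtain ⟨r, hr, hlt⟩ := (lt_isLUB_iff (isLUB_kdSet hH hdeg x y hlam)).1 hlt
    obtain ⟨h, b, hn, hb, hf, rfl⟩ := hR lam hlam r hr
    exact ⟨diffOrder h, hlam, h, b, hn, hb, rfl, hf, hlt⟩
  -- There are finitely many orders on a finite vertex set, so one of them occurs frequently.
  obtain ⟨t, h2⟩ : ∃ t : V → V → V → V → Prop, ∃ᶠ lam in 𝓝[>] (0 : ℝ), 0 < lam ∧ ∃ h b,
      ‖(h, b)‖ ≤ R ∧ H.IsSelection b h ∧ diffOrder h = t ∧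
      H.IsLip 1 (h + lam • H.selLaplacian b h) ∧ H.dist x y - a * lam < h x - h y := by
    by_contra hcon
    simp only [not_exists, not_frequently] at hcon
    refine h1 ((eventually_all.2 hcon).mono fun lam hlam => ?_)
    rintro ⟨t, h⟩
    exact hlam t h
  obtain ⟨l, hl, hprop⟩ := exists_seq_forall_of_frequently h2
  choose hpos h b hn hb ht hf hlt using hprop
  exact ⟨R, l, h, b, tendsto_nhds_of_tendsto_nhdsWithin hl, hpos, hn, hb,
    fun m n => (ht m).trans (ht n).symm, hf, hlt⟩

/-- One good witness at a small parameter `l m` is interpolated with the limit `φ` to serve all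
smaller parameters; the gap `c - a` pays for the difference of their Laplacians. -/
theorem eventually_le_kd (hH : H.Connected) (hdeg : ∀ z, 0 < H.deg z) {a c : ℝ} (hac : a < c)
    (hfreq : ∃ᶠ lam in 𝓝[>] (0 : ℝ), H.dist x y - a * lam < H.kd lam x y) :
    ∀ᶠ lam in 𝓝[>] (0 : ℝ), H.dist x y - c * lam ≤ H.kd lam x y := by
  obtain ⟨R, l, h, b, hl, hpos, hn, hb, ht, hf, hlt⟩ := exists_seq_of_frequently hH hdeg hfreq
  obtain ⟨φ, b₀, k, hk, hφ, hu, hb₀, hcross⟩ := exists_limit_data hn hb ht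
  set u := H.selLaplacian b₀ φ
  have hlk : Tendsto (fun n => l (k n)) atTop (𝓝 0) := hl.comp hk.tendsto_atTop
  have hφLip : H.IsLip 1 φ := by
    refine isLip_of_tendsto (fun n => hf (k n)) ?_
    simpa using hφ.add (hlk.smul hu)
  have hφd : (H.dist x y : ℝ) ≤ φ x - φ y := by
    rw [tendsto_pi_nhds] at hφ
    refine le_of_tendsto_of_tendsto ?_ ((hφ x).sub (hφ y))
      (Eventually.of_forall fun n => (hlt (k n)).le)
    simpa using (hlk.const_mul a).const_sub (H.dist x y : ℝ)
  -- This is what `(d - c * lam) * (1 + 2 * lam * ε) ≤ d - a * lam` requires when `0 < lam < 1`.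
  obtain ⟨ε, hε0, hε⟩ : ∃ ε : ℝ, 0 < ε ∧ ε * (2 * H.dist x y + 2 * |c|) ≤ c - a := by
    refine ⟨(c - a) / (2 * H.dist x y + 2 * |c| + 1), div_pos (sub_pos.2 hac) (by positivity), ?_⟩
    rw [div_mul_eq_mul_div, div_le_iff₀ (by positivity)]
    exact mul_le_mul_of_nonneg_left (by linarith) (sub_pos.2 hac).le
  obtain ⟨n, hnε⟩ := ((Metric.tendsto_nhds.1 hu) ε hε0).exists
  set m := k n
  filter_upwards [self_mem_nhdsWithin,
    nhdsWithin_le_nhds (Iio_mem_nhds (hpos m)), nhdsWithin_le_nhds (Iio_mem_nhds one_pos)]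
    with lam hlam hlm hl1
  simp only [Set.mem_Ioi, Set.mem_Iio] at hlam hlm hl1
  set s := lam / l m with hs
  have hsl : s * l m = lam := div_mul_cancel₀ _ (hpos m).ne'
  have hs0 : 0 ≤ s := div_nonneg hlam.le (hpos m).le
  have hs1 : s ≤ 1 := (div_le_one (hpos m)).2 hlm.le
  obtain ⟨b', hb', hlap⟩ := hb₀.exists_convexComb (hcross m).1 (hcross m).2 (hb m) hs0 hs1
  set v := H.selLaplacian (b m) (h m)
  have hLip : H.IsLip (1 + 2 * (lam * ε)) ((1 - s) • φ + s • h m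
      + lam • H.selLaplacian b' ((1 - s) • φ + s • h m)) := by
    -- Since `s * l m = lam`, the term `lam • v` splits into `s • (l m • v)`, completing the
    -- 1-Lipschitz function of `h m`, and `(lam * (1 - s)) • v`, which enters the error.
    have h1 : (1 - s) • φ + s • h m + lam • H.selLaplacian b' ((1 - s) • φ + s • h m)
        = ((1 - s) • φ + s • (h m + l m • v)) + (lam * (1 - s)) • (u - v) := by
      rw [hlap]
      funext z
      simp only [Pi.add_apply, Pi.smul_apply, Pi.sub_apply, smul_eq_mul]
      linear_combination (-v z) * hsl
    rw [h1]
    refine (hφLip.convexComb hs0 hs1 (hf m)).add_of_abs_le hH fun z => ?_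
    have h2 : |u z - v z| ≤ ε := by
      rw [abs_sub_comm]
      exact (_root_.dist_le_pi_dist v u z).trans hnε.le
    rw [Pi.smul_apply, smul_eq_mul, abs_mul, abs_of_nonneg (mul_nonneg hlam.le (sub_nonneg.2 hs1))]
    exact mul_le_mul (mul_le_of_le_one_right hlam.le (by linarith)) h2 (abs_nonneg _) hlam.le
  have hK : 0 < 1 + 2 * (lam * ε) := by positivity
  refine le_trans ?_ ((isLUB_kdSet hH hdeg x y hlam).1 (hb'.div_mem_kdSet hdeg hK hLip))
  rw [le_div_iff₀ hK]
  have h3 : H.dist x y - a * lam ≤ ((1 - s) • φ + s • h m) x - ((1 - s) • φ + s • h m) y := by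
    simp only [Pi.add_apply, Pi.smul_apply, smul_eq_mul]
    have h4 := mul_le_mul_of_nonneg_left hφd (sub_nonneg.2 hs1)
    have h5 := mul_le_mul_of_nonneg_left (hlt m).le hs0
    have h6 : s * (H.dist x y - a * l m) = s * H.dist x y - a * lam := by
      rw [← hsl]; ring
    linarith
  refine le_trans ?_ h3
  have h7 : -(c * lam) ≤ |c| := by
    have : |c| * lam ≤ |c| * 1 := mul_le_mul_of_nonneg_left hl1.le (abs_nonneg c)
    have := mul_le_mul_of_nonneg_right (neg_abs_le c) hlam.le
    linarith
  have h8 := mul_le_mul_of_nonneg_left h7 (mul_pos hlam hε0).le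
  have h9 := mul_le_mul_of_nonneg_left hε hlam.le
  linarith

/-- A bounded quotient converges if it cannot be frequently below `a` and frequently above some `c >
a`; `eventually_le_kd` forbids exactly that. -/
theorem exists_tendsto_kd (hH : H.Connected) (hdeg : ∀ z, 0 < H.deg z) (x y : V) :
    ∃ c, Tendsto (fun lam => (H.dist x y - H.kd lam x y) / lam) (𝓝[>] (0 : ℝ)) (𝓝 c) := by
  obtain ⟨C, hC⟩ := exists_kd_bounds hH hdeg x y
  have hpos : ∀ᶠ lam in 𝓝[>] (0 : ℝ), 0 < lam := self_mem_nhdsWithin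
  refine tendsto_of_no_upcrossings dense_univ ?_ ⟨C, ?_⟩ ⟨-C, ?_⟩
  · rintro a - c - hac ⟨h1, h2⟩
    have h3 : ∃ᶠ lam in 𝓝[>] (0 : ℝ), H.dist x y - a * lam < H.kd lam x y := by
      refine (h1.and_eventually hpos).mono fun lam ⟨hlt, hlam⟩ => ?_
      rw [div_lt_iff₀ hlam] at hlt
      linarith
    refine h2 ((hpos.and (eventually_le_kd hH hdeg hac h3)).mono fun lam ⟨hlam, hle⟩ => ?_)
    rw [not_lt, div_le_iff₀ hlam]
    linarith
  · refine eventually_map.2 (hpos.mono fun lam hlam => ?_)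
    obtain ⟨r, hr, hle⟩ := (hC lam hlam).2
    have := (isLUB_kdSet hH hdeg x y hlam).1 hr
    rw [div_le_iff₀ hlam]
    linarith
  · refine eventually_map.2 (hpos.mono fun lam hlam => ?_)
    have := (isLUB_kdSet hH hdeg x y hlam).2 (hC lam hlam).1
    refine (le_div_iff₀ hlam).2 ?_
    linarith

end Limit
end WeightedHypergraph

theorem mainTheorem1 {V : Type*} [Fintype V] [DecidableEq V] (H : WeightedHypergraph V)
    (hH : H.Connected) (x y : V) (hxy : x ≠ y) :
    (∀ lam : ℝ, 0 < lam → IsLUB (H.kdSet lam x y) (H.kd lam x y)) ∧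
    H.lowerCurvature x y = H.upperCurvature x y ∧
    ∃ κ : ℝ, H.lowerCurvature x y = (κ : EReal) ∧
      Tendsto (fun lam : ℝ => 1 / lam * (1 - H.kd lam x y / H.dist x y)) (𝓝[>] 0) (𝓝 κ) := by
  -- A lone vertex could lie in no hyperedge and have degree 0.
  have : Nontrivial V := ⟨x, y, hxy⟩
  have hdeg := hH.deg_pos
  have hd : (H.dist x y : ℝ) ≠ 0 := by
    have := hH.one_le_dist hxy
    positivity
  obtain ⟨c, hc⟩ := WeightedHypergraph.exists_tendsto_kd hH hdeg x y
  have hlim : Tendsto (fun lam : ℝ => H.curvature lam x y / lam) (𝓝[>] 0)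
      (𝓝 (c / H.dist x y)) := by
    refine (hc.div_const (H.dist x y : ℝ)).congr fun lam => ?_
    rw [WeightedHypergraph.curvature, div_right_comm, sub_div, div_self hd]
  have hE := (continuous_coe_real_ereal.tendsto _).comp hlim
  have hlow : H.lowerCurvature x y = ((c / H.dist x y : ℝ) : EReal) := hE.liminf_eq
  have hup : H.upperCurvature x y = ((c / H.dist x y : ℝ) : EReal) := hE.limsup_eq
  refine ⟨fun lam hlam => WeightedHypergraph.isLUB_kdSet hH hdeg x y hlam, hlow.trans hup.symm,
    _, hlow, hlim.congr fun lam => ?_⟩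
  rw [WeightedHypergraph.curvature, div_eq_mul_one_div, mul_comm]
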